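/- Let $k$ be a field of characteristic different from $2$ and let $d\ge 0$. A superspace is a finite dimensional $k$-vector space $M=M_0\oplus M_1$ graded by $\mathbb{Z}/2$. The symmetric group $\mathfrak{S}_d$ acts on the right on $M^{\otimes d}$ so that, for homogeneous $v_1,\dots,v_d$, the transposition $(i\ \,i{+}1)$ sends $v_1\otimes\cdots\otimes v_d$ to $(-1)^{|v_i||v_{i+1}|}\,v_1\otimes\cdots\otimes v_{i+1}\otimes v_i\otimes\cdots\otimes v_d$. Let $\mathsf{\Gamma}^d$ be the category whose objects are the superspaces and whose morphisms $M\to N$ are the elements of the superspace $\Gamma^d\mathrm{Hom}(M,N)\simeq\mathrm{Hom}_{k\mathfrak{S}_d}(M^{\otimes d},N^{\otimes d})$, composed as linear maps. Let $\mathsf{Pol}^{\mathsf I}_d$ be the category whose objects are the $k$-linear, parity-preserving functors $T$ from $\mathsf{\Gamma}^d$ to the category of superspaces and all linear maps. A morphism $\eta:S\to T$ of $\mathsf{Pol}^{\mathsf I}_d$ is a family of linear maps $\eta(M)=\eta_0(M)+\eta_1(M):S(M)\to T(M)$ with $\eta_\varepsilon(M)$ homogeneous of degree $\varepsilon$ and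 $T(f)\circ\eta_\varepsilon(M)=(-1)^{\varepsilon|f|}\,\eta_\varepsilon(N)\circ S(f)$ for all homogeneous $f\in\Gamma^d\mathrm{Hom}(M,N)$. Let $\lambda$ be a partition with $|\lambda|=d$ and conjugate $\lambda'$. For a superspace $M$ put $S^\lambda(M)=S^{\lambda_1}(M)\otimes S^{\lambda_2}(M)\otimes\cdots$, where $S^n(M)=(M^{\otimes n})_{\mathfrak{S}_n}$, and $\Gamma_\Pi^{\lambda'}(M)=\Gamma_\Pi^{\lambda'_1}(M)\otimes\Gamma_\Pi^{\lambda'_2}(M)\otimes\cdots$, where $\Gamma_\Pi^n(M)=\mathrm{Hom}_{k\mathfrak{S}_n}((k^{0|1})^{\otimes n},M^{\otimes n})$. Let $\Delta_\Pi:\Gamma_\Pi^{\lambda'}(M)\to M^{\otimes d}$ be the canonical embedding, given by evaluation at a generator of the line $(k^{0|1})^{\otimes d}$, and let $m:M^{\otimes d}\to S^\lambda(M)$ be the multiplication. Let $\sigma_\lambda\in\mathfrak{S}_d$ be the permutation that sends the number of each cell of the Young diagram of $\lambda$ in the row-by-row numbering to its number in the column-by-column numbering. The Schur superfunctor $\widehat{S}_\lambda\in\mathsf{Pol}^{\mathsf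 I}_d$ is defined by $$\widehat{S}_\lambda(M)=\mathrm{Im}\Big(\Gamma_\Pi^{\lambda'}(M)\xrightarrow{\ \Delta_\Pi\ }M^{\otimes d}\xrightarrow{\ \sigma_\lambda\ }M^{\otimes d}\xrightarrow{\ m\ }S^\lambda(M)\Big),$$ with the action of $\mathsf{\Gamma}^d$ inherited from $S^\lambda$. Proposition. For every partition $\lambda$ with $|\lambda|=d$, the Schur superfunctor $\widehat{S}_\lambda$ is an indecomposable object of $\mathsf{Pol}^{\mathsf I}_d$: it is nonzero, and whenever $\widehat{S}_\lambda\cong S\oplus T$ with $S,T\in\mathsf{Pol}^{\mathsf I}_d$, either $S=0$ or $T=0$. -/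

import Mathlib

open CategoryTheory CategoryTheory.Limits
open scoped TensorProduct

universe u

namespace SuperPoly

/-! ## Superspaces -/

/-- A finite dimensional vector superspace `M = M₀ ⊕ M₁` over `k`. -/
structure SVec (k : Type u) [Field k] where
  carrier : Type u
  [addCommGroup : AddCommGroup carrier]
  [module : Module k carrier]
  [finite : Module.Finite k carrier]
  part : ZMod 2 → Submodule k carrier
  isCompl : IsCompl (part 0) (part 1)

attribute [instance] SVec.addCommGroup SVec.module SVec.finite

instance (k : Type u) [Field k] : CoeSort (SVec k) (Type u) := ⟨SVec.carrier⟩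

theorem zmod_two_cases (e : ZMod 2) : e = 0 ∨ e = 1 := by
  revert e; decide

variable {k : Type u} [Field k]

theorem SVec.isCompl_part (M : SVec k) (e : ZMod 2) : IsCompl (M.part e) (M.part (e + 1)) := by
  rcases zmod_two_cases e with rfl | rfl
  · simpa using M.isCompl
  · have h : (1 + 1 : ZMod 2) = 0 := by decide
    rw [h]; exact M.isCompl.symm

/-- The projection of `M = M₀ ⊕ M₁` onto its component `M_e`, as an endomorphism of `M`. -/
noncomputable def SVec.proj (M : SVec k) (e : ZMod 2) : M →ₗ[k] M :=
  (M.part e).projection (M.part (e + 1)) (M.isCompl_part e)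

theorem SVec.proj_mem (M : SVec k) (e : ZMod 2) (x : M) : M.proj e x ∈ M.part e :=
  Submodule.projection_apply_mem _ _

theorem SVec.proj_of_mem (M : SVec k) (e : ZMod 2) {x : M} (hx : x ∈ M.part e) :
    M.proj e x = x :=
  Submodule.projection_apply_of_mem_left _ hx

theorem SVec.proj_of_mem_ne (M : SVec k) {e e' : ZMod 2} (h : e ≠ e') {x : M}
    (hx : x ∈ M.part e') : M.proj e x = 0 := by
  have h' : e' = e + 1 := by
    clear hx
    revert e e'
    decide
  subst h'
  exact Submodule.projection_apply_of_mem_right _ hx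

theorem SVec.proj_add (M : SVec k) (x : M) : M.proj 0 x + M.proj 1 x = x := by
  have hx : x ∈ M.part 0 ⊔ M.part 1 := by rw [M.isCompl.sup_eq_top]; trivial
  obtain ⟨a, ha, b, hb, rfl⟩ := Submodule.mem_sup.1 hx
  simp [map_add, M.proj_of_mem 0 ha, M.proj_of_mem 1 hb,
    M.proj_of_mem_ne (by decide : (0 : ZMod 2) ≠ 1) hb,
    M.proj_of_mem_ne (by decide : (1 : ZMod 2) ≠ 0) ha]

/-- `Hom(M, N)_e`: the linear maps with `f (M_δ) ⊆ N_{e+δ}`. -/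
def homPart (M N : SVec k) (e : ZMod 2) : Submodule k (M →ₗ[k] N) where
  carrier := {f | ∀ δ : ZMod 2, ∀ x ∈ M.part δ, f x ∈ N.part (e + δ)}
  add_mem' hf hg δ x hx := (N.part _).add_mem (hf δ x hx) (hg δ x hx)
  zero_mem' _ _ _ := (N.part _).zero_mem
  smul_mem' c _ hf δ x hx := (N.part _).smul_mem c (hf δ x hx)

theorem comp_mem_homPart {M N P : SVec k} {e e' : ZMod 2} {g : N →ₗ[k] P} {f : M →ₗ[k] N}
    (hg : g ∈ homPart N P e) (hf : f ∈ homPart M N e') : g ∘ₗ f ∈ homPart M P (e + e') :=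
  fun δ x hx => by
    have := hg _ _ (hf δ x hx)
    rwa [← add_assoc] at this

theorem id_mem_homPart (M : SVec k) : LinearMap.id ∈ homPart M M 0 := fun δ x hx => by
  simpa using hx

theorem proj_comm {M N : SVec k} {f : M →ₗ[k] N} (hf : f ∈ homPart M N 0) (e : ZMod 2) (x : M) :
    N.proj e (f x) = f (M.proj e x) := by
  have h : ∀ δ, ∀ y ∈ M.part δ, N.proj e (f y) = f (M.proj e y) := by
    intro δ y hy
    have h1 : f y ∈ N.part δ := by simpa using hf δ y hy
    by_cases hd : e = δ
    · subst hd; rw [N.proj_of_mem e h1, M.proj_of_mem e hy]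
    · rw [N.proj_of_mem_ne hd h1, M.proj_of_mem_ne hd hy, map_zero]
  rw [← M.proj_add x]
  simp only [map_add]
  rw [h 0 _ (M.proj_mem 0 x), h 1 _ (M.proj_mem 1 x)]

/-- The purely odd line `k^{0|1}`. -/
def oddLine (k : Type u) [Field k] : SVec k where
  carrier := k
  part e := if e = 1 then ⊤ else ⊥
  isCompl := by simpa using isCompl_bot_top

/-! ## Tensor powers and the signed action of the symmetric group -/

/-- The degree `e` component of `M^{⊗d}`: the span of the `v₁ ⊗ ⋯ ⊗ v_d` with all `vᵢ`
homogeneous and total degree `e`. -/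
def tpowPart (M : SVec k) (d : ℕ) (e : ZMod 2) : Submodule k (⨂[k] _ : Fin d, M) :=
  Submodule.span k {x | ∃ (a : Fin d → ZMod 2) (v : Fin d → M),
    ∑ i, a i = e ∧ (∀ i, v i ∈ M.part (a i)) ∧ PiTensorProduct.tprod k v = x}

theorem sum_map_proj (M : SVec k) (d : ℕ) (x : ⨂[k] _ : Fin d, M) :
    ∑ a : Fin d → ZMod 2, PiTensorProduct.map (fun i => M.proj (a i)) x = x := by
  induction x using PiTensorProduct.induction_on with
  | smul_tprod r v =>
    simp only [map_smul, PiTensorProduct.map_tprod, ← Finset.smul_sum]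
    congr 1
    rw [← MultilinearMap.map_sum (PiTensorProduct.tprod k) (fun i (e : ZMod 2) => M.proj e (v i))]
    congr 1
    funext i
    exact (Fin.sum_univ_two (fun e : Fin 2 => M.proj e (v i))).trans (M.proj_add (v i))
  | add x y hx hy =>
    simp only [map_add, Finset.sum_add_distrib, hx, hy]

theorem map_proj_of_homogeneous (M : SVec k) {d : ℕ} (a b : Fin d → ZMod 2) (v : Fin d → M)
    (hv : ∀ i, v i ∈ M.part (b i)) :
    PiTensorProduct.map (fun i => M.proj (a i)) (PiTensorProduct.tprod k v) =
      if a = b then PiTensorProduct.tprod k v else 0 := by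
  rw [PiTensorProduct.map_tprod]
  split_ifs with h
  · subst h
    congr 1
    funext i
    exact M.proj_of_mem _ (hv i)
  · obtain ⟨i, hi⟩ := Function.ne_iff.1 h
    exact MultilinearMap.map_coord_zero _ i (M.proj_of_mem_ne hi (hv i))

theorem map_proj_mem (M : SVec k) {d : ℕ} (a : Fin d → ZMod 2) (x : ⨂[k] _ : Fin d, M) :
    PiTensorProduct.map (fun i => M.proj (a i)) x ∈ tpowPart M d (∑ i, a i) := by
  induction x using PiTensorProduct.induction_on with
  | smul_tprod r v =>
    rw [map_smul, PiTensorProduct.map_tprod]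
    exact Submodule.smul_mem _ _
      (Submodule.subset_span ⟨a, _, rfl, fun i => M.proj_mem _ _, rfl⟩)
  | add x y hx hy => rw [map_add]; exact Submodule.add_mem _ hx hy

theorem isCompl_tpowPart (M : SVec k) (d : ℕ) : IsCompl (tpowPart M d 0) (tpowPart M d 1) := by
  let P : (⨂[k] _ : Fin d, M) →ₗ[k] (⨂[k] _ : Fin d, M) :=
    ∑ a : Fin d → ZMod 2, if ∑ i, a i = 0 then PiTensorProduct.map (fun i => M.proj (a i)) else 0
  have hP : ∀ (b : Fin d → ZMod 2) (v : Fin d → M), (∀ i, v i ∈ M.part (b i)) →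
      P (PiTensorProduct.tprod k v) = if ∑ i, b i = 0 then PiTensorProduct.tprod k v else 0 := by
    intro b v hv
    simp only [P, LinearMap.sum_apply]
    rw [Finset.sum_eq_single b]
    · split_ifs
      · rw [map_proj_of_homogeneous M b b v hv, if_pos rfl]
      · rfl
    · intro a _ hab
      split_ifs
      · rw [map_proj_of_homogeneous M a b v hv, if_neg hab]
      · rfl
    · simp
  have h0 : ∀ x ∈ tpowPart M d 0, P x = x := by
    intro x hx
    induction hx using Submodule.span_induction with
    | mem x h => obtain ⟨a, v, ha, hv, rfl⟩ := h; rw [hP a v hv, if_pos ha]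
    | zero => simp
    | add x y _ _ hx hy => rw [map_add, hx, hy]
    | smul c x _ hx => rw [map_smul, hx]
  have h1 : ∀ x ∈ tpowPart M d 1, P x = 0 := by
    intro x hx
    induction hx using Submodule.span_induction with
    | mem x h =>
      obtain ⟨a, v, ha, hv, rfl⟩ := h
      rw [hP a v hv, if_neg (by rw [ha]; decide)]
    | zero => simp
    | add x y _ _ hx hy => rw [map_add, hx, hy, add_zero]
    | smul c x _ hx => rw [map_smul, hx, smul_zero]
  constructor
  · rw [Submodule.disjoint_def]
    intro x hx0 hx1
    rw [← h0 x hx0, h1 x hx1]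
  · rw [codisjoint_iff, eq_top_iff]
    intro x _
    rw [← sum_map_proj M d x]
    refine Submodule.sum_mem _ fun a _ => ?_
    have := map_proj_mem M a x
    rcases zmod_two_cases (∑ i, a i) with h | h
    · rw [h] at this; exact Submodule.mem_sup_left this
    · rw [h] at this; exact Submodule.mem_sup_right this

/-- The superspace `M^{⊗d}`. -/
noncomputable abbrev SVec.tpow (M : SVec k) (d : ℕ) : SVec k where
  carrier := ⨂[k] _ : Fin d, M
  part := tpowPart M d
  isCompl := isCompl_tpowPart M d

/-- `sgn(a, σ) = ∏ (-1)^{a_s a_t}` over the pairs `s < t` with `σ⁻¹ s > σ⁻¹ t`. -/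
def superSign (k : Type u) [Field k] {d : ℕ} (a : Fin d → ZMod 2) (σ : Equiv.Perm (Fin d)) : k :=
  ∏ p : Fin d × Fin d,
    if p.1 < p.2 ∧ σ.symm p.2 < σ.symm p.1 then (-1 : k) ^ (a p.1 * a p.2).val else 1

/-- The right action `x ↦ x.σ` of `σ ∈ 𝔖_d` on `M^{⊗d}`: for homogeneous `vᵢ` of degree `aᵢ`,
`(v₁ ⊗ ⋯ ⊗ v_d).σ = sgn(a, σ) v_{σ1} ⊗ ⋯ ⊗ v_{σd}` (see `superAct_tprod`). -/
noncomputable def superAct (M : SVec k) {d : ℕ} (σ : Equiv.Perm (Fin d)) :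
    (⨂[k] _ : Fin d, M) →ₗ[k] (⨂[k] _ : Fin d, M) :=
  ∑ a : Fin d → ZMod 2, superSign k a σ •
    ((PiTensorProduct.reindex k (fun _ : Fin d => (M : Type u)) σ.symm).toLinearMap ∘ₗ
      PiTensorProduct.map (fun i => M.proj (a i)))

theorem superAct_tprod (M : SVec k) {d : ℕ} (σ : Equiv.Perm (Fin d)) (a : Fin d → ZMod 2)
    (v : Fin d → M) (hv : ∀ i, v i ∈ M.part (a i)) :
    superAct M σ (PiTensorProduct.tprod k v) =
      superSign k a σ • PiTensorProduct.tprod k (fun i => v (σ i)) := by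
  unfold superAct
  rw [LinearMap.sum_apply, Finset.sum_eq_single a]
  · rw [LinearMap.smul_apply, LinearMap.comp_apply, map_proj_of_homogeneous M a a v hv, if_pos rfl]
    congr 1
    exact PiTensorProduct.reindex_tprod _ _
  · intro b _ hb
    rw [LinearMap.smul_apply, LinearMap.comp_apply, map_proj_of_homogeneous M b a v hv,
      if_neg hb, map_zero, smul_zero]
  · simp

theorem superAct_mem_homPart (M : SVec k) {d : ℕ} (σ : Equiv.Perm (Fin d)) :
    superAct M σ ∈ homPart (M.tpow d) (M.tpow d) 0 := by
  intro δ x hx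
  rw [zero_add]
  change x ∈ tpowPart M d δ at hx
  change superAct M σ x ∈ tpowPart M d δ
  induction hx using Submodule.span_induction with
  | mem x h =>
    obtain ⟨a, v, ha, hv, rfl⟩ := h
    rw [superAct_tprod M σ a v hv]
    refine Submodule.smul_mem _ _ (Submodule.subset_span
      ⟨fun i => a (σ i), fun i => v (σ i), ?_, fun i => hv _, rfl⟩)
    rw [← ha]
    exact Equiv.sum_comp σ a
  | zero => rw [map_zero]; exact Submodule.zero_mem _
  | add x y _ _ hx hy => rw [map_add]; exact Submodule.add_mem _ hx hy
  | smul c x _ hx => rw [map_smul]; exact Submodule.smul_mem _ _ hx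

/-- The linear maps `M^{⊗d} → N^{⊗d}` commuting with the signed action of the subgroup `H`
of `𝔖_d`. -/
def equivHom {d : ℕ} (H : Subgroup (Equiv.Perm (Fin d))) (M N : SVec k) :
    Submodule k (M.tpow d →ₗ[k] N.tpow d) where
  carrier := {f | ∀ σ ∈ H, f ∘ₗ superAct M σ = superAct N σ ∘ₗ f}
  add_mem' hf hg σ hσ := by
    rw [LinearMap.add_comp, LinearMap.comp_add, hf σ hσ, hg σ hσ]
  zero_mem' σ _ := by rw [LinearMap.zero_comp, LinearMap.comp_zero]
  smul_mem' c _ hf σ hσ := by rw [LinearMap.smul_comp, LinearMap.comp_smul, hf σ hσ]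

theorem equivHom_mono {d : ℕ} {H K : Subgroup (Equiv.Perm (Fin d))} (h : H ≤ K) (M N : SVec k) :
    equivHom K M N ≤ equivHom H M N := fun _ hf σ hσ => hf σ (h hσ)

theorem comp_mem_equivHom {d : ℕ} {H : Subgroup (Equiv.Perm (Fin d))} {M N P : SVec k}
    {g : N.tpow d →ₗ[k] P.tpow d} {f : M.tpow d →ₗ[k] N.tpow d}
    (hg : g ∈ equivHom H N P) (hf : f ∈ equivHom H M N) : g ∘ₗ f ∈ equivHom H M P := by
  intro σ hσ
  rw [LinearMap.comp_assoc, hf σ hσ, ← LinearMap.comp_assoc, hg σ hσ, LinearMap.comp_assoc]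

/-! ## The category `Γ^d` and polynomial superfunctors of type I -/

/-- The space of morphisms `M → N` of the category `Γ^d_M`, whose objects are the finite
dimensional superspaces: `Γ^d Hom(M, N) = Hom_{k𝔖_d}(M^{⊗d}, N^{⊗d})`. -/
abbrev GammaHom (d : ℕ) (M N : SVec k) : Type u :=
  equivHom (⊤ : Subgroup (Equiv.Perm (Fin d))) M N

/-- The identity morphism of `M` in `Γ^d_M`. -/
def GammaHom.id (d : ℕ) (M : SVec k) : GammaHom d M M :=
  ⟨LinearMap.id, fun σ _ => by rw [LinearMap.id_comp, LinearMap.comp_id]⟩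

/-- The composition of morphisms `f : M → N` and `g : N → P` of `Γ^d_M`. -/
def GammaHom.comp {d : ℕ} {M N P : SVec k} (g : GammaHom d N P) (f : GammaHom d M N) :
    GammaHom d M P :=
  ⟨g.1 ∘ₗ f.1, comp_mem_equivHom g.2 f.2⟩

/-- `f` is homogeneous of degree `e` in the superspace of morphisms `M → N` of `Γ^d_M`. -/
def GammaHom.IsHomogeneous {d : ℕ} {M N : SVec k} (f : GammaHom d M N) (e : ZMod 2) : Prop :=
  f.1 ∈ homPart (M.tpow d) (N.tpow d) e

/-- An object of `Pol^I_d`: an even `k`-linear functor from `Γ^d_M` to the category `svec` of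
finite dimensional superspaces and all linear maps. -/
structure Pol (k : Type u) [Field k] (d : ℕ) where
  obj : SVec k → SVec k
  map {M N : SVec k} : GammaHom d M N →ₗ[k] (obj M →ₗ[k] obj N)
  map_id : ∀ M : SVec k, map (GammaHom.id d M) = LinearMap.id
  map_comp : ∀ {M N P : SVec k} (g : GammaHom d N P) (f : GammaHom d M N),
    map (g.comp f) = map g ∘ₗ map f
  map_even : ∀ {M N : SVec k} (f : GammaHom d M N) (e : ZMod 2), f.IsHomogeneous e →
    map f ∈ homPart (obj M) (obj N) e

variable {d : ℕ}

/-- A morphism `η = η₀ + η₁ : S → T` of `Pol^I_d`, that is, an `Svec`-enriched natural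
transformation: `η_e(M)` is homogeneous of degree `e`, and
`T(f) ∘ η_e(M) = (-1)^{e|f|} η_e(N) ∘ S(f)` for homogeneous `f : M → N`. -/
@[ext]
structure Pol.Hom (S T : Pol k d) where
  app : ZMod 2 → ∀ M : SVec k, S.obj M →ₗ[k] T.obj M
  homogeneous : ∀ (e : ZMod 2) (M : SVec k), app e M ∈ homPart (S.obj M) (T.obj M) e
  natural : ∀ (e δ : ZMod 2) {M N : SVec k} (f : GammaHom d M N), f.IsHomogeneous δ →
    T.map f ∘ₗ app e M = (-1 : k) ^ (δ * e).val • (app e N ∘ₗ S.map f)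

namespace Pol

theorem Hom.natural_apply {S T : Pol k d} (η : Hom S T) (e δ : ZMod 2) {M N : SVec k}
    (f : GammaHom d M N) (hf : f.IsHomogeneous δ) (x : S.obj M) :
    T.map f (η.app e M x) = (-1 : k) ^ (δ * e).val • η.app e N (S.map f x) :=
  LinearMap.congr_fun (η.natural e δ f hf) x

theorem sign_mul (δ a b : ZMod 2) :
    (-1 : k) ^ (δ * a).val * (-1 : k) ^ (δ * b).val = (-1 : k) ^ (δ * (a + b)).val := by
  have h : ∀ δ a b : ZMod 2,
      ((δ * a).val + (δ * b).val) % 2 = (δ * (a + b)).val % 2 := by decide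
  rw [← pow_add, neg_one_pow_eq_pow_mod_two, h, ← neg_one_pow_eq_pow_mod_two]

/-- The identity transformation: it is even. -/
def Hom.id (S : Pol k d) : Hom S S where
  app e M := if e = 0 then LinearMap.id else 0
  homogeneous e M := by
    split_ifs with h
    · subst h; exact id_mem_homPart _
    · exact Submodule.zero_mem _
  natural e δ M N f _ := by
    split_ifs with h
    · subst h; simp
    · simp

/-- The composition: `(θη)_e = θ₀ η_e + θ₁ η_{e+1}`. -/
def Hom.comp {S T U : Pol k d} (η : Hom S T) (θ : Hom T U) : Hom S U where
  app e M := ∑ a : ZMod 2, θ.app a M ∘ₗ η.app (e - a) M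
  homogeneous e M := Submodule.sum_mem _ fun a _ => by
    have := comp_mem_homPart (θ.homogeneous a M) (η.homogeneous (e - a) M)
    rwa [add_sub_cancel] at this
  natural e δ M N f hf := by
    ext x
    simp only [LinearMap.comp_apply, LinearMap.smul_apply, LinearMap.sum_apply, map_sum,
      Finset.smul_sum]
    refine Finset.sum_congr rfl fun a _ => ?_
    rw [θ.natural_apply a δ f hf, η.natural_apply (e - a) δ f hf, map_smul, smul_smul, sign_mul,
      add_sub_cancel]

theorem sum_zmod_two {A : Type*} [AddCommMonoid A] (g : ZMod 2 → A) : ∑ a, g a = g 0 + g 1 :=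
  Fin.sum_univ_two (f := g)

instance : Category (Pol k d) where
  Hom := Hom
  id := Hom.id
  comp := Hom.comp
  id_comp η := by
    ext e M x
    rcases zmod_two_cases e with rfl | rfl <;> simp [Hom.comp, Hom.id, sum_zmod_two]
  comp_id η := by
    ext e M x
    rcases zmod_two_cases e with rfl | rfl <;> simp [Hom.comp, Hom.id, sum_zmod_two]
  assoc η θ ζ := by
    have h : (0 - 1 : ZMod 2) = 1 := by decide
    ext e M x
    rcases zmod_two_cases e with rfl | rfl <;> simp [Hom.comp, sum_zmod_two, h] <;> abel

theorem hom_ext {S T : Pol k d} {η θ : S ⟶ T} (h : ∀ e M x, Hom.app η e M x = Hom.app θ e M x) :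
    η = θ :=
  Hom.ext (funext fun e => funext fun M => LinearMap.ext fun x => h e M x)

instance (S T : Pol k d) : Zero (Hom S T) where
  zero :=
    { app := fun _ _ => 0
      homogeneous := fun _ _ => Submodule.zero_mem _
      natural := fun _ _ _ _ _ _ => by simp }

instance (S T : Pol k d) : Add (Hom S T) where
  add η θ :=
    { app := fun e M => η.app e M + θ.app e M
      homogeneous := fun e M => Submodule.add_mem _ (η.homogeneous e M) (θ.homogeneous e M)
      natural := fun e δ _ _ f hf => by
        rw [LinearMap.comp_add, LinearMap.add_comp, smul_add, η.natural e δ f hf,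
          θ.natural e δ f hf] }

instance (S T : Pol k d) : Neg (Hom S T) where
  neg η :=
    { app := fun e M => -η.app e M
      homogeneous := fun e M => Submodule.neg_mem _ (η.homogeneous e M)
      natural := fun e δ _ _ f hf => by
        rw [LinearMap.comp_neg, LinearMap.neg_comp, smul_neg, η.natural e δ f hf] }

instance (S T : Pol k d) : AddCommGroup (Hom S T) where
  add_assoc η θ ζ := Hom.ext (funext fun _ => funext fun _ => add_assoc _ _ _)
  zero_add η := Hom.ext (funext fun _ => funext fun _ => zero_add _)
  add_zero η := Hom.ext (funext fun _ => funext fun _ => add_zero _)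
  add_comm η θ := Hom.ext (funext fun _ => funext fun _ => add_comm _ _)
  neg_add_cancel η := Hom.ext (funext fun _ => funext fun _ => neg_add_cancel _)
  nsmul := nsmulRec
  zsmul := zsmulRec

theorem add_app {S T : Pol k d} (η θ : Hom S T) (e : ZMod 2) (M : SVec k) :
    (η + θ).app e M = η.app e M + θ.app e M := rfl

theorem zero_app {S T : Pol k d} (e : ZMod 2) (M : SVec k) :
    (0 : Hom S T).app e M = 0 := rfl

theorem add_comp_app {S T U : Pol k d} (η η' : Hom S T) (θ : Hom T U) (e : ZMod 2) (M : SVec k)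
    (x : S.obj M) : (Hom.comp (η + η') θ).app e M x =
      (Hom.comp η θ + Hom.comp η' θ).app e M x := by
  simp [Hom.comp, add_app, sum_zmod_two]
  abel

theorem comp_add_app {S T U : Pol k d} (η : Hom S T) (θ θ' : Hom T U) (e : ZMod 2) (M : SVec k)
    (x : S.obj M) : (Hom.comp η (θ + θ')).app e M x =
      (Hom.comp η θ + Hom.comp η θ').app e M x := by
  simp [Hom.comp, add_app, sum_zmod_two]
  abel

instance : Preadditive (Pol k d) where
  homGroup S T := inferInstanceAs (AddCommGroup (Hom S T))
  add_comp S T U η η' θ := by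
    refine hom_ext fun e M x => ?_
    change (Hom.comp (Add.add (α := Hom S T) η η') θ).app e M x = (Hom.comp η θ + Hom.comp η' θ).app e M x
    exact add_comp_app η η' θ e M x
  comp_add S T U η θ θ' := by
    refine hom_ext fun e M x => ?_
    change (Hom.comp η (Add.add (α := Hom T U) θ θ')).app e M x = (Hom.comp η θ + Hom.comp η θ').app e M x
    exact comp_add_app η θ θ' e M x

end Pol

/-- The direct sum of superspaces. -/
abbrev SVec.sum (M N : SVec k) : SVec k where
  carrier := M × N
  part e := (M.part e).prod (N.part e)
  isCompl := by
    constructor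
    · rw [Submodule.disjoint_def]
      rintro ⟨x, y⟩ ⟨hx0, hy0⟩ ⟨hx1, hy1⟩
      exact Prod.ext (Submodule.disjoint_def.1 M.isCompl.disjoint x hx0 hx1)
        (Submodule.disjoint_def.1 N.isCompl.disjoint y hy0 hy1)
    · rw [codisjoint_iff, eq_top_iff]
      rintro ⟨x, y⟩ _
      refine Submodule.mem_sup.2 ⟨(M.proj 0 x, N.proj 0 y), ⟨M.proj_mem 0 x, N.proj_mem 0 y⟩,
        (M.proj 1 x, N.proj 1 y), ⟨M.proj_mem 1 x, N.proj_mem 1 y⟩, ?_⟩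
      exact Prod.ext (M.proj_add x) (N.proj_add y)

namespace Pol

/-- The direct sum of polynomial superfunctors, formed objectwise. -/
abbrev sum (S T : Pol k d) : Pol k d where
  obj M := (S.obj M).sum (T.obj M)
  map {M N} :=
    { toFun := fun f => LinearMap.prodMap (S.map f) (T.map f)
      map_add' := fun f g => by rw [map_add, map_add]; rfl
      map_smul' := fun c f => by rw [map_smul, map_smul]; rfl }
  map_id M := by
    change LinearMap.prodMap _ _ = _
    rw [S.map_id, T.map_id]
    rfl
  map_comp g f := by
    change LinearMap.prodMap _ _ = LinearMap.prodMap _ _ ∘ₗ LinearMap.prodMap _ _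
    rw [S.map_comp, T.map_comp]
    rfl
  map_even f e hf δ x hx := ⟨S.map_even f e hf δ _ hx.1, T.map_even f e hf δ _ hx.2⟩

/-- A natural family of even maps, as a morphism of `Pol^I_d`. -/
def Hom.ofEven {S T : Pol k d} (η : ∀ M : SVec k, S.obj M →ₗ[k] T.obj M)
    (h : ∀ M, η M ∈ homPart (S.obj M) (T.obj M) 0)
    (hη : ∀ (M N : SVec k) (f : GammaHom d M N), T.map f ∘ₗ η M = η N ∘ₗ S.map f) : Hom S T where
  app e M := if e = 0 then η M else 0
  homogeneous e M := by
    split_ifs with he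
    · subst he; exact h M
    · exact Submodule.zero_mem _
  natural e δ M N f _ := by
    split_ifs with he
    · subst he; simp [hη]
    · simp

theorem ofEven_comp_ofEven {S T U : Pol k d} {η : ∀ M : SVec k, S.obj M →ₗ[k] T.obj M}
    {h : ∀ M, η M ∈ homPart (S.obj M) (T.obj M) 0}
    {hη : ∀ (M N : SVec k) (f : GammaHom d M N), T.map f ∘ₗ η M = η N ∘ₗ S.map f}
    {θ : ∀ M : SVec k, T.obj M →ₗ[k] U.obj M}
    {h' : ∀ M, θ M ∈ homPart (T.obj M) (U.obj M) 0}
    {hθ : ∀ (M N : SVec k) (f : GammaHom d M N), U.map f ∘ₗ θ M = θ N ∘ₗ T.map f}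
    (e : ZMod 2) (M : SVec k) (x : S.obj M) :
    (Hom.comp (Hom.ofEven η h hη) (Hom.ofEven θ h' hθ)).app e M x =
      if e = 0 then θ M (η M x) else 0 := by
  rcases zmod_two_cases e with rfl | rfl <;> simp [Hom.comp, Hom.ofEven, sum_zmod_two]

theorem id_app (S : Pol k d) (e : ZMod 2) (M : SVec k) (x : S.obj M) :
    (Hom.id S).app e M x = if e = 0 then x else 0 := by
  rcases zmod_two_cases e with rfl | rfl <;> simp [Hom.id]

/-- The projections and inclusions of the objectwise direct sum. -/
def fstHom (S T : Pol k d) : Hom (sum S T) S :=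
  Hom.ofEven (S := sum S T) (fun M => LinearMap.fst k (S.obj M) (T.obj M))
    (fun M δ x hx => by rw [zero_add]; exact hx.1) (fun _ _ f => rfl)

def sndHom (S T : Pol k d) : Hom (sum S T) T :=
  Hom.ofEven (S := sum S T) (fun M => LinearMap.snd k (S.obj M) (T.obj M))
    (fun M δ x hx => by rw [zero_add]; exact hx.2) (fun _ _ f => rfl)

def inlHom (S T : Pol k d) : Hom S (sum S T) :=
  Hom.ofEven (T := sum S T) (fun M => LinearMap.inl k (S.obj M) (T.obj M))
    (fun M δ x hx => by rw [zero_add]; exact ⟨hx, Submodule.zero_mem _⟩)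
    (fun _ _ f => LinearMap.ext fun x => Prod.ext rfl (map_zero (T.map f)))

def inrHom (S T : Pol k d) : Hom T (sum S T) :=
  Hom.ofEven (T := sum S T) (fun M => LinearMap.inr k (S.obj M) (T.obj M))
    (fun M δ x hx => by rw [zero_add]; exact ⟨Submodule.zero_mem _, hx⟩)
    (fun _ _ f => LinearMap.ext fun x => Prod.ext (map_zero (S.map f)) rfl)

/-- The biproduct diagram on the objectwise direct sum. -/
def bicone (S T : Pol k d) : BinaryBicone S T where
  pt := sum S T
  fst := fstHom S T
  snd := sndHom S T
  inl := inlHom S T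
  inr := inrHom S T
  inl_fst := by
    refine hom_ext fun e M x => ?_
    refine (ofEven_comp_ofEven e M x).trans ((id_app _ e M x).trans ?_).symm
    split_ifs <;> rfl
  inl_snd := by
    refine hom_ext fun e M x => ?_
    refine (ofEven_comp_ofEven e M x).trans ?_
    split_ifs <;> rfl
  inr_fst := by
    refine hom_ext fun e M x => ?_
    refine (ofEven_comp_ofEven e M x).trans ?_
    split_ifs <;> rfl
  inr_snd := by
    refine hom_ext fun e M x => ?_
    refine (ofEven_comp_ofEven e M x).trans ((id_app _ e M x).trans ?_).symm
    split_ifs <;> rfl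

theorem bicone_total (S T : Pol k d) (e : ZMod 2) (M : SVec k) (x : (sum S T).obj M) :
    (Hom.comp (fstHom S T) (inlHom S T)).app e M x +
      (Hom.comp (sndHom S T) (inrHom S T)).app e M x = (Hom.id (sum S T)).app e M x := by
  have h1 : (Hom.comp (fstHom S T) (inlHom S T)).app e M x = if e = 0 then (x.1, 0) else 0 :=
    ofEven_comp_ofEven e M x
  have h2 : (Hom.comp (sndHom S T) (inrHom S T)).app e M x = if e = 0 then (0, x.2) else 0 :=
    ofEven_comp_ofEven e M x
  rw [id_app, h1, h2]
  split_ifs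
  · exact Prod.ext (add_zero _) (zero_add _)
  · exact add_zero _

instance : HasBinaryBiproducts (Pol k d) where
  has_binary_biproduct S T := hasBinaryBiproduct_of_total (bicone S T)
    (hom_ext fun e M x => bicone_total S T e M x)

end Pol

/-! ## Schur superfunctors -/

/-- The subgroup of the permutations of `{1, …, d}` that preserve the blocks (the fibres
of `b`). -/
def youngSubgroup (b : Fin d → ℕ) : Subgroup (Equiv.Perm (Fin d)) where
  carrier := {σ | ∀ i, b (σ i) = b i}
  mul_mem' {σ τ} hσ hτ i := by rw [Equiv.Perm.mul_apply, hσ, hτ]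
  one_mem' _ := rfl
  inv_mem' {σ} hσ i := by rw [← hσ (σ⁻¹ i)]; simp

/-- The span of all `x.σ - x` with `x ∈ M^{⊗d}` and `σ ∈ H`. -/
noncomputable def symRel (H : Subgroup (Equiv.Perm (Fin d))) (M : SVec k) :
    Submodule k (M.tpow d) :=
  Submodule.span k {y | ∃ σ ∈ H, ∃ x, superAct M σ x - x = y}

theorem proj_mem_symRel (H : Subgroup (Equiv.Perm (Fin d))) (M : SVec k) (e : ZMod 2)
    {x : M.tpow d} (hx : x ∈ symRel H M) : (M.tpow d).proj e x ∈ symRel H M := by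
  unfold symRel at hx
  induction hx using Submodule.span_induction with
  | mem x h =>
    obtain ⟨σ, hσ, x, rfl⟩ := h
    rw [map_sub, proj_comm (superAct_mem_homPart M σ)]
    exact Submodule.subset_span ⟨σ, hσ, _, rfl⟩
  | zero => rw [map_zero]; exact Submodule.zero_mem _
  | add x y _ _ hx hy => rw [map_add]; exact Submodule.add_mem _ hx hy
  | smul c x _ hx => rw [map_smul]; exact Submodule.smul_mem _ _ hx

/-- The coinvariants `(M^{⊗d})_H` as a superspace. For the Young subgroup `H = 𝔖_α` this is
`S^α(M) = S^{α₁}(M) ⊗ S^{α₂}(M) ⊗ ⋯`, and the quotient map is the multiplication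
`m : M^{⊗d} → S^α(M)`. -/
noncomputable abbrev symPow (H : Subgroup (Equiv.Perm (Fin d))) (M : SVec k) : SVec k where
  carrier := M.tpow d ⧸ symRel H M
  part e := ((M.tpow d).part e).map (symRel H M).mkQ
  isCompl := by
    constructor
    · rw [Submodule.disjoint_def]
      rintro _ ⟨a, ha, rfl⟩ ⟨b, hb, hab⟩
      have h1 : a - b ∈ symRel H M := by
        rw [← Submodule.ker_mkQ (symRel H M), LinearMap.mem_ker, map_sub, hab, sub_self]
      have h2 := proj_mem_symRel H M 0 h1
      rw [map_sub, (M.tpow d).proj_of_mem 0 ha, (M.tpow d).proj_of_mem_ne (by decide) hb,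
        sub_zero] at h2
      rwa [← LinearMap.mem_ker, Submodule.ker_mkQ]
    · rw [codisjoint_iff, ← Submodule.map_sup, (M.tpow d).isCompl.sup_eq_top,
        Submodule.map_top, Submodule.range_mkQ]

/-- The action of a morphism of `Γ^d_M` on the coinvariants. -/
noncomputable def symMap (H : Subgroup (Equiv.Perm (Fin d))) {M N : SVec k} (f : GammaHom d M N) :
    symPow H M →ₗ[k] symPow H N :=
  (symRel H M).mapQ (symRel H N) f.1 (by
    rw [symRel, Submodule.span_le]
    rintro _ ⟨σ, hσ, x, rfl⟩
    refine Submodule.subset_span ⟨σ, hσ, f.1 x, ?_⟩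
    rw [map_sub]
    exact congrArg (· - f.1 x) (LinearMap.congr_fun (f.2 σ trivial) x).symm)

/-- The cells of `lam` (row index, column index; both from `0`) listed row by row. -/
def rowReading (lam : YoungDiagram) (h : lam.card = d) : Fin d ≃ lam.cells :=
  ((lam.cells.map (toLex : ℕ × ℕ ≃ ℕ ×ₗ ℕ).toEmbedding).orderIsoOfFin
      ((Finset.card_map _).trans h)).toEquiv.trans
    ((toLex : ℕ × ℕ ≃ ℕ ×ₗ ℕ).subtypeEquiv (by simp)).symm

/-- The cells of `lam` listed column by column. -/
def colReading (lam : YoungDiagram) (h : lam.card = d) : Fin d ≃ lam.cells :=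
  ((lam.cells.map ((Equiv.prodComm ℕ ℕ).trans (toLex : ℕ × ℕ ≃ ℕ ×ₗ ℕ)).toEmbedding).orderIsoOfFin
      ((Finset.card_map _).trans h)).toEquiv.trans
    (((Equiv.prodComm ℕ ℕ).trans (toLex : ℕ × ℕ ≃ ℕ ×ₗ ℕ)).subtypeEquiv (by simp)).symm

/-- The permutation `σ_λ`: it sends the number of a cell in the row by row numbering to its
number in the column by column numbering. -/
def sigmaPerm (lam : YoungDiagram) (h : lam.card = d) : Equiv.Perm (Fin d) :=
  (rowReading lam h).trans (colReading lam h).symm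

/-- `𝔖_λ = 𝔖_{λ₁} × 𝔖_{λ₂} × ⋯`: the first `λ₁` numbers form the first block, and so on. -/
def rowGroup (lam : YoungDiagram) (h : lam.card = d) : Subgroup (Equiv.Perm (Fin d)) :=
  youngSubgroup fun r => (rowReading lam h r).1.1

/-- `𝔖_{λ'}` for the conjugate partition `λ'`: the first `λ'₁` numbers form the first block,
and so on. -/
def colGroup (lam : YoungDiagram) (h : lam.card = d) : Subgroup (Equiv.Perm (Fin d)) :=
  youngSubgroup fun r => (colReading lam h r).1.2

/-- `Γ_Π^{λ'}(M)`. Since `Γ_Π^n(M) = Hom_{Γ^n}(k^{0|1}, M) = Hom_{k𝔖_n}((k^{0|1})^{⊗n}, M^{⊗n})`,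
the tensor product over the parts `n` of `λ'` consists of the `𝔖_{λ'}`-equivariant maps
`(k^{0|1})^{⊗d} → M^{⊗d}`. -/
noncomputable abbrev gammaPi (lam : YoungDiagram) (h : lam.card = d) (M : SVec k) :
    Submodule k ((oddLine k).tpow d →ₗ[k] M.tpow d) :=
  equivHom (colGroup lam h) (oddLine k) M

/-- The canonical embedding `Δ_Π : Γ_Π^{λ'}(M) → M^{⊗d}`, the evaluation at the generator
`1 ⊗ ⋯ ⊗ 1` of `(k^{0|1})^{⊗d}`. -/
noncomputable def deltaPi (lam : YoungDiagram) (h : lam.card = d) (M : SVec k) :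
    gammaPi lam h M →ₗ[k] M.tpow d :=
  LinearMap.applyₗ (PiTensorProduct.tprod k fun _ : Fin d => (1 : k) : (oddLine k).tpow d) ∘ₗ
    (gammaPi lam h M).subtype

/-- The map `θ_λ(M) : Γ_Π^{λ'}(M) → M^{⊗d} → M^{⊗d} → S^λ(M)`. -/
noncomputable def theta (lam : YoungDiagram) (h : lam.card = d) (M : SVec k) :
    gammaPi lam h M →ₗ[k] symPow (rowGroup lam h) M :=
  (symRel (rowGroup lam h) M).mkQ ∘ₗ superAct M (sigmaPerm lam h) ∘ₗ deltaPi lam h M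

theorem proj_comp_mem (H : Subgroup (Equiv.Perm (Fin d))) {M N : SVec k} (e : ZMod 2)
    {f : M.tpow d →ₗ[k] N.tpow d} (hf : f ∈ equivHom H M N) :
    (N.tpow d).proj e ∘ₗ f ∈ equivHom H M N := by
  intro σ hσ
  rw [LinearMap.comp_assoc, hf σ hσ]
  exact LinearMap.ext fun x => proj_comm (superAct_mem_homPart N σ) e (f x)

theorem theta_proj_mem (lam : YoungDiagram) (h : lam.card = d) (M : SVec k) (e : ZMod 2)
    (f : gammaPi lam h M) :
    theta lam h M ⟨(M.tpow d).proj e ∘ₗ f.1, proj_comp_mem _ e f.2⟩ ∈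
      (symPow (rowGroup lam h) M).part e := by
  refine ⟨_, ?_, rfl⟩
  have := superAct_mem_homPart M (sigmaPerm lam h) e _ ((M.tpow d).proj_mem e (deltaPi lam h M f))
  rw [zero_add] at this
  exact this

theorem theta_natural (lam : YoungDiagram) (h : lam.card = d) {M N : SVec k}
    (f : GammaHom d M N) (g : gammaPi lam h M) :
    symMap (rowGroup lam h) f (theta lam h M g) =
      theta lam h N ⟨f.1 ∘ₗ g.1, comp_mem_equivHom (equivHom_mono le_top _ _ f.2) g.2⟩ :=
  congrArg (symRel (rowGroup lam h) N).mkQ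
    (LinearMap.congr_fun (f.2 (sigmaPerm lam h) trivial) (deltaPi lam h M g))

/-- The superspace `Ŝ_λ(M)`: the image of `θ_λ(M)`, a subsuperspace of `S^λ(M)`. -/
noncomputable abbrev schurObj (lam : YoungDiagram) (h : lam.card = d) (M : SVec k) : SVec k where
  carrier := LinearMap.range (theta lam h M)
  part e := ((symPow (rowGroup lam h) M).part e).comap (LinearMap.range (theta lam h M)).subtype
  isCompl := by
    constructor
    · rw [Submodule.disjoint_def]
      intro x h0 h1
      exact Subtype.ext (Submodule.disjoint_def.1
        (symPow (rowGroup lam h) M).isCompl.disjoint x.1 h0 h1)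
    · rw [codisjoint_iff, eq_top_iff]
      rintro ⟨_, f, rfl⟩ _
      refine Submodule.mem_sup.2
        ⟨⟨_, _, rfl⟩, theta_proj_mem lam h M 0 f, ⟨_, _, rfl⟩, theta_proj_mem lam h M 1 f, ?_⟩
      refine Subtype.ext ?_
      change theta lam h M _ + theta lam h M _ = theta lam h M f
      rw [← map_add]
      refine congrArg (theta lam h M) (Subtype.ext (LinearMap.ext fun x => ?_))
      exact (M.tpow d).proj_add (f.1 x)

/-- The Schur superfunctor `Ŝ_λ = Im θ_λ`, an object of `Pol^I_d`. -/
noncomputable def schur (k : Type u) [Field k] (lam : YoungDiagram) (h : lam.card = d) :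
    Pol k d where
  obj M := schurObj lam h M
  map {M N} :=
    { toFun := fun f => (symMap (rowGroup lam h) f).restrict (by
        rintro _ ⟨g, rfl⟩
        exact ⟨_, (theta_natural lam h f g).symm⟩)
      map_add' := fun f g => by
        refine LinearMap.ext fun ⟨x, hx⟩ => Subtype.ext ?_
        obtain ⟨x, rfl⟩ := Submodule.mkQ_surjective _ x
        rfl
      map_smul' := fun c f => by
        refine LinearMap.ext fun ⟨x, hx⟩ => Subtype.ext ?_
        obtain ⟨x, rfl⟩ := Submodule.mkQ_surjective _ x
        rfl }
  map_id M := by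
    refine LinearMap.ext fun ⟨x, hx⟩ => Subtype.ext ?_
    obtain ⟨x, rfl⟩ := Submodule.mkQ_surjective _ x
    rfl
  map_comp g f := by
    refine LinearMap.ext fun ⟨x, hx⟩ => Subtype.ext ?_
    obtain ⟨x, rfl⟩ := Submodule.mkQ_surjective _ x
    rfl
  map_even f e hf := by
    rintro δ ⟨_, hx⟩ ⟨x, hxδ, rfl⟩
    exact ⟨f.1 x, hf δ x hxδ, rfl⟩

end SuperPoly

namespace SuperPoly

variable {k : Type u} [Field k] {d : ℕ}

/-! ## The signed action is a right action -/

/-! The only endomorphisms of `schur k lam h` are the scalars. A scalar idempotent is 0 or 1, so a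
nonzero functor with this property cannot split.

The proof is a highest weight argument carried out in the purely odd superspace `V` with one basis
vector `e_j` per column of `lam`. Let `c` be the word of columns in the column-by-column numbering,
and let `w` (`schurGen`) be the image of `e_c` in the value of the functor at `V`. Three facts are
needed.

Generation (`mem_span_map_schurGen`). The image of Δ_Π in `M^{⊗d}` consists of the tensors `y` that
transform by the sign under the stabilizer of `c`. For each of them, Frobenius reciprocity gives a
morphism `V → M` of Γ^d taking `e_c` to `y` (`extendHom`). Hence the images of `w` span the functor,
and an endomorphism is determined by its value on `w`.

One-dimensional weight space (`exists_map_weightHom_eq_smul`). An idempotent of Γ^d End(V) fixes `w`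
and maps the whole value at `V` into the line `k w`. On odd vectors the symmetric powers are
alternating, since 2 is invertible. So a rearrangement of the columns survives only if no row
repeats a column, and a count (`mem_of_injective_on_rows`) shows that each row then holds its own
columns in some order. Naturality against this idempotent makes the even part of an endomorphism
multiply `w` by a scalar.

Parity. The value at `V` lies entirely in degree `d` mod 2, so the odd part of an endomorphism kills
`w`.

Finally `w ≠ 0`, because an alternating functional separates it from the relations
(`mkQ_tensorBasis_ne_zero`). -/

theorem prod_pairs_eq_prod_lt {A : Type*} [CommMonoid A] (g : Fin d × Fin d → A)
    (hg : ∀ i, g (i, i) = 1) :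
    ∏ p, g p = ∏ p : Fin d × Fin d, if p.1 < p.2 then g p * g p.swap else 1 := by
  have h1 : ∏ p, g p = (∏ p : Fin d × Fin d, if p.1 < p.2 then g p else 1) *
      ∏ p : Fin d × Fin d, if p.2 < p.1 then g p else 1 := by
    rw [← Finset.prod_mul_distrib]
    refine Finset.prod_congr rfl fun p _ => ?_
    rcases lt_trichotomy p.1 p.2 with h | h | h
    · rw [if_pos h, if_neg h.not_gt, mul_one]
    · obtain ⟨i, j⟩ := p
      obtain rfl : i = j := h
      simp [hg]
    · rw [if_pos h, if_neg h.not_gt, one_mul]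
  rw [h1, ← (Equiv.prodComm (Fin d) (Fin d)).prod_comp (fun p => if p.2 < p.1 then g p else 1),
    ← Finset.prod_mul_distrib]
  refine Finset.prod_congr rfl fun p _ => ?_
  by_cases h : p.1 < p.2
  · simp [h]
  · simp [h]

/-- A pair of positions contributes its sign each time its order is reversed. A pair reversed by
both factors contributes twice on the right, which cancels, and is not reversed by the product. -/
theorem superSign_mul (a : Fin d → ZMod 2) (σ τ : Equiv.Perm (Fin d)) :
    superSign k a (σ * τ) = superSign k a σ * superSign k (fun i => a (σ i)) τ := by
  have hsq : ∀ n : ℕ, (-1 : k) ^ n * (-1 : k) ^ n = 1 := fun n => by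
    rw [← mul_pow]; simp
  have h2 : superSign k (fun i => a (σ i)) τ = ∏ p : Fin d × Fin d,
      if σ.symm p.1 < σ.symm p.2 ∧ τ.symm (σ.symm p.2) < τ.symm (σ.symm p.1) then
        (-1 : k) ^ (a p.1 * a p.2).val else 1 := by
    rw [← (Equiv.prodCongr σ σ).prod_comp]
    simp [superSign]
  -- After transport along `σ`, the factor of a pair may sit at `(s, t)` or at `(t, s)`. Folding the
  -- product onto `s < t` allows a comparison pair by pair.
  rw [h2, prod_pairs_eq_prod_lt _ (by simp), superSign, superSign, ← Finset.prod_mul_distrib]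
  refine Finset.prod_congr rfl fun p _ => ?_
  obtain ⟨s, t⟩ := p
  by_cases h : s < t
  swap
  · simp [h]
  have e1 : (σ * τ).symm s = τ.symm (σ.symm s) := rfl
  have e2 : (σ * τ).symm t = τ.symm (σ.symm t) := rfl
  have hne : σ.symm s ≠ σ.symm t := σ.symm.injective.ne h.ne
  have hne' : τ.symm (σ.symm s) ≠ τ.symm (σ.symm t) := τ.symm.injective.ne hne
  simp only [h, true_and, if_true, e1, e2, Prod.swap, mul_comm (a t)]
  rcases hne.lt_or_gt with h1 | h1 <;> rcases hne'.lt_or_gt with h3 | h3 <;>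
    simp [h1, h3, h1.not_gt, h3.not_gt, hsq]

theorem superAct_mul (M : SVec k) (σ τ : Equiv.Perm (Fin d)) (x : M.tpow d) :
    superAct M (σ * τ) x = superAct M τ (superAct M σ x) := by
  have h : ∀ (a : Fin d → ZMod 2) (v : Fin d → M), (∀ i, v i ∈ M.part (a i)) →
      superAct M (σ * τ) (PiTensorProduct.tprod k v) =
        superAct M τ (superAct M σ (PiTensorProduct.tprod k v)) := by
    intro a v hv
    rw [superAct_tprod M _ a v hv, superAct_tprod M σ a v hv, map_smul,
      superAct_tprod M τ (fun i => a (σ i)) _ (fun i => hv _), smul_smul, superSign_mul]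
    rfl
  have h' : ∀ e, ∀ x ∈ tpowPart M d e,
      superAct M (σ * τ) x = superAct M τ (superAct M σ x) := by
    intro e x hx
    induction hx using Submodule.span_induction with
    | mem x hx => obtain ⟨a, v, -, hv, rfl⟩ := hx; exact h a v hv
    | zero => simp
    | add x y _ _ hx hy => simp only [map_add, hx, hy]
    | smul c x _ hx => simp only [map_smul, hx]
  rw [← (M.tpow d).proj_add x]
  simp only [map_add]
  rw [h' 0 _ ((M.tpow d).proj_mem 0 x), h' 1 _ ((M.tpow d).proj_mem 1 x)]

/-- The sign by which `σ` acts on the `d`-th tensor power of an odd line. -/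
theorem superSign_one_eq_sign (σ : Equiv.Perm (Fin d)) :
    superSign k (fun _ => 1) σ = ((Equiv.Perm.sign σ : ℤ) : k) := by
  have h1 : (-1 : k) ^ (1 * 1 : ZMod 2).val = -1 := by
    rw [show (1 * 1 : ZMod 2).val = 1 from rfl, pow_one]
  rw [← Equiv.Perm.sign_inv, Equiv.Perm.sign_eq_prod_prod_Ioi, superSign, Fintype.prod_prod_type]
  simp only [Units.coe_prod, Int.cast_prod, h1]
  refine Finset.prod_congr rfl fun s _ => ?_
  rw [← Finset.prod_subset (Finset.subset_univ (Finset.Ioi s))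
    (fun t _ ht => if_neg fun h => ht (Finset.mem_Ioi.2 h.1))]
  refine Finset.prod_congr rfl fun t ht => ?_
  have hst := Finset.mem_Ioi.1 ht
  have hne : σ.symm s ≠ σ.symm t := σ.symm.injective.ne hst.ne
  change _ = (((if σ.symm s < σ.symm t then 1 else -1 : ℤˣ) : ℤ) : k)
  rcases hne.lt_or_gt with h | h <;> simp [h, h.not_gt, hst]

/-! ## Fillings of Young diagrams -/

/-- A permutation of the column indices of the cells that is injective on each row keeps
each row in the diagram. -/
theorem mem_of_injective_on_rows (lam : YoungDiagram) (r : Fin d ≃ lam.cells)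
    (σ : Equiv.Perm (Fin d))
    (hinj : ∀ i j, (r i).1.1 = (r j).1.1 → (r (σ i)).1.2 = (r (σ j)).1.2 → i = j) (i : Fin d) :
    ((r i).1.1, (r (σ i)).1.2) ∈ lam := by
  classical
  by_contra hi
  set n := (r (σ i)).1.2 with hn
  -- In row `m` there are at most min(`rowLen m`, `n`) new entries below `n`, since they are
  -- distinct. The original filling attains this bound.
  have hle : ∀ m ∈ lam.cells.image Prod.fst,
      (Finset.univ.filter fun j : Fin d => (r (σ j)).1.2 < n ∧ (r j).1.1 = m).card ≤
        (Finset.univ.filter fun j : Fin d => (r j).1.2 < n ∧ (r j).1.1 = m).card := by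
    intro m _
    by_cases hm : lam.rowLen m ≤ n
    · refine Finset.card_le_card fun j hj => ?_
      simp only [Finset.mem_filter, Finset.mem_univ, true_and] at hj ⊢
      refine ⟨lt_of_lt_of_le ?_ hm, hj.2⟩
      rw [← YoungDiagram.mem_iff_lt_rowLen, ← hj.2]
      exact (YoungDiagram.mem_cells _).1 (r j).2
    · have hmem : ∀ j : Fin d, (r (σ j)).1.2 < n → (m, (r (σ j)).1.2) ∈ lam.cells := fun j hj =>
        (YoungDiagram.mem_cells _).2 (YoungDiagram.mem_iff_lt_rowLen.2 (hj.trans (not_le.1 hm)))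
      refine Finset.card_le_card_of_injOn (fun j => if hj : (r (σ j)).1.2 < n then
        r.symm ⟨_, hmem j hj⟩ else j) ?_ ?_
      · intro j hj
        have hj' : (r (σ j)).1.2 < n ∧ (r j).1.1 = m := by simpa using hj
        simp [hj'.1]
      · intro j hj l hl hjl
        have hj' : (r (σ j)).1.2 < n ∧ (r j).1.1 = m := by simpa using hj
        have hl' : (r (σ l)).1.2 < n ∧ (r l).1.1 = m := by simpa using hl
        simp only [hj'.1, hl'.1, dif_pos, EmbeddingLike.apply_eq_iff_eq, Subtype.mk.injEq,
          Prod.mk.injEq, true_and] at hjl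
        exact hinj j l (hj'.2.trans hl'.2.symm) hjl
  have hrow : ∀ j : Fin d, (r j).1.1 ∈ lam.cells.image Prod.fst := fun j =>
    Finset.mem_image_of_mem _ (r j).2
  -- The total number of entries below `n` does not change under a permutation, so every rowwise
  -- inequality is an equality.
  have htot : (Finset.univ.filter fun j : Fin d => (r (σ j)).1.2 < n).card =
      (Finset.univ.filter fun j : Fin d => (r j).1.2 < n).card :=
    Finset.card_bij (fun j _ => σ j) (fun j hj => by simpa using hj)
      (fun _ _ _ _ h => σ.injective h) (fun j hj => ⟨σ.symm j, by simpa using hj, by simp⟩)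
  rw [Finset.card_eq_sum_card_fiberwise (f := fun j => (r j).1.1) (fun j _ => hrow j),
    Finset.card_eq_sum_card_fiberwise (f := fun j => (r j).1.1)
      (s := Finset.univ.filter fun j : Fin d => (r j).1.2 < n) (fun j _ => hrow j)] at htot
  simp only [Finset.filter_filter] at htot
  have heq := (Finset.sum_eq_sum_iff_of_le hle).1 htot _ (hrow i)
  have hlen : lam.rowLen (r i).1.1 ≤ n := by
    rw [YoungDiagram.mem_iff_lt_rowLen] at hi
    exact not_lt.1 hi
  have hlt : ∀ j : Fin d, (r j).1.1 = (r i).1.1 → (r j).1.2 < n := fun j hj => by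
    refine lt_of_lt_of_le ?_ hlen
    rw [← YoungDiagram.mem_iff_lt_rowLen, ← hj]
    exact (YoungDiagram.mem_cells _).1 (r j).2
  -- The row of `i` has length at most `n`, so all its original entries are below `n`. The new entry
  -- at `i` equals `n`, so equality fails in this row.
  refine heq.not_lt (Finset.card_lt_card ⟨fun j hj => ?_, fun hsub => ?_⟩)
  · simp only [Finset.mem_filter, Finset.mem_univ, true_and] at hj ⊢
    exact ⟨hlt j hj.2, hj.2⟩
  · have : i ∈ Finset.univ.filter fun j : Fin d => (r j).1.2 < n ∧ (r j).1.1 = (r i).1.1 := by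
      simp [hlt i rfl]
    exact lt_irrefl n (Finset.mem_filter.1 (hsub this)).2.1

/-! ## Signs -/

/-- The sign of a permutation as a scalar. -/
noncomputable def scalarSign (k : Type u) [Field k] (σ : Equiv.Perm (Fin d)) : k :=
  ((Equiv.Perm.sign σ : ℤ) : k)

theorem scalarSign_mul (σ τ : Equiv.Perm (Fin d)) :
    scalarSign k (σ * τ) = scalarSign k σ * scalarSign k τ := by
  simp [scalarSign]

theorem scalarSign_mul_self (σ : Equiv.Perm (Fin d)) :
    scalarSign k σ * scalarSign k σ = 1 := by
  rcases Int.units_eq_one_or (Equiv.Perm.sign σ) with h | h <;> simp [scalarSign, h]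

theorem scalarSign_one : scalarSign k (1 : Equiv.Perm (Fin d)) = 1 := by
  simp [scalarSign]

theorem scalarSign_ne_zero (σ : Equiv.Perm (Fin d)) : scalarSign k σ ≠ 0 := fun h => by
  simpa [h] using scalarSign_mul_self (k := k) σ

/-- `y` transforms by the sign under the stabilizer of the multi-index `c`. -/
def IsSignedFor {I : Type} (c : Fin d → I) {M : SVec k} (y : M.tpow d) : Prop :=
  ∀ σ : Equiv.Perm (Fin d), c ∘ σ = c → superAct M σ y = scalarSign k σ • y

theorem isSignedFor_proj {I : Type} {c : Fin d → I} {M : SVec k} {y : M.tpow d}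
    (hy : IsSignedFor c y) (e : ZMod 2) :
    IsSignedFor c ((M.tpow d).proj e y) := fun σ hσ => by
  rw [← proj_comm (superAct_mem_homPart M σ), hy σ hσ, map_smul]

/-! ## Tensor powers of purely odd superspaces -/

section OddSpace

variable {I : Type} [Fintype I]

/-- The purely odd superspace `k^{0|I}`. -/
def oddSpace (k : Type u) [Field k] (I : Type) [Fintype I] : SVec k where
  carrier := I → k
  part e := if e = 1 then ⊤ else ⊥
  isCompl := by simpa using isCompl_bot_top

theorem mem_oddSpace_part (x : oddSpace k I) : x ∈ (oddSpace k I).part 1 := by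
  simp only [oddSpace, if_true]
  trivial

/-- The standard basis of `k^{0|I}`. -/
noncomputable def oddBasis (k : Type u) [Field k] (I : Type) [Fintype I] :
    Module.Basis I k (oddSpace k I) :=
  Pi.basisFun k I

/-- The basis `e_a = e_{a 1} ⊗ ⋯ ⊗ e_{a d}` of `(k^{0|I})^{⊗d}`. -/
noncomputable def tensorBasis (k : Type u) [Field k] (I : Type) [Fintype I] (d : ℕ) :
    Module.Basis (Fin d → I) k ((oddSpace k I).tpow d) :=
  Basis.piTensorProduct fun _ => oddBasis k I

theorem tensorBasis_apply (a : Fin d → I) :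
    tensorBasis k I d a = PiTensorProduct.tprod k fun i => oddBasis k I (a i) :=
  Basis.piTensorProduct_apply _ _

theorem superAct_tensorBasis (σ : Equiv.Perm (Fin d)) (a : Fin d → I) :
    superAct (oddSpace k I) σ (tensorBasis k I d a) =
      scalarSign k σ • tensorBasis k I d (a ∘ σ) := by
  rw [tensorBasis_apply, tensorBasis_apply,
    superAct_tprod _ σ (fun _ => 1) _ fun i => mem_oddSpace_part _, superSign_one_eq_sign]
  rfl

/-- The tensor power of a purely odd superspace is concentrated in degree `d`. -/
theorem oddSpace_tpow_eq_zero {e : ZMod 2} (he : e ≠ d) {x : (oddSpace k I).tpow d}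
    (hx : x ∈ ((oddSpace k I).tpow d).part e) : x = 0 := by
  change x ∈ tpowPart (oddSpace k I) d e at hx
  induction hx using Submodule.span_induction with
  | mem x hx =>
    obtain ⟨a, v, ha, hv, rfl⟩ := hx
    by_cases h : ∀ i, a i = 1
    · refine absurd ?_ he
      rw [← ha]
      simp [h]
    · push Not at h
      obtain ⟨i, hi⟩ := h
      refine MultilinearMap.map_coord_zero _ i ?_
      have hvi := hv i
      simp only [oddSpace, if_neg hi] at hvi
      exact (Submodule.mem_bot k).1 hvi
  | zero => rfl
  | add x y _ _ hx hy => rw [hx, hy, add_zero]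
  | smul c x _ hx => rw [hx, smul_zero]

theorem mem_oddSpace_tpow_part (x : (oddSpace k I).tpow d) :
    x ∈ ((oddSpace k I).tpow d).part d := by
  have h : (d : ZMod 2) + 1 ≠ d := by simp
  have := IsCompl.sup_eq_top (((oddSpace k I).tpow d).isCompl_part d)
  have hx : x ∈ ((oddSpace k I).tpow d).part d ⊔ ((oddSpace k I).tpow d).part (d + 1) := by
    rw [this]; trivial
  obtain ⟨y, hy, z, hz, rfl⟩ := Submodule.mem_sup.1 hx
  rwa [oddSpace_tpow_eq_zero h hz, add_zero]

/-! ## Morphisms out of a purely odd superspace -/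

open Classical in
/-- The linear map `(k^{0|I})^{⊗d} → M^{⊗d}` with `e_{c ∘ σ} ↦ sgn(σ) y.σ` that vanishes on the
other basis vectors. -/
noncomputable def extendMap (c : Fin d → I) {M : SVec k} (y : M.tpow d) :
    (oddSpace k I).tpow d →ₗ[k] M.tpow d :=
  (tensorBasis k I d).constr k fun a =>
    if h : ∃ σ : Equiv.Perm (Fin d), c ∘ σ = a then
      scalarSign k h.choose • superAct M h.choose y else 0

variable {c : Fin d → I} {M : SVec k} {y : M.tpow d}

/-- The chosen permutation does not matter: two choices differ by an element of the stabilizer of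
`c`, on which `y` transforms by the sign. -/
theorem extendMap_of_orbit (hy : IsSignedFor c y) (σ : Equiv.Perm (Fin d)) :
    extendMap c y (tensorBasis k I d (c ∘ σ)) = scalarSign k σ • superAct M σ y := by
  have h : ∃ τ : Equiv.Perm (Fin d), c ∘ τ = c ∘ σ := ⟨σ, rfl⟩
  rw [extendMap, Module.Basis.constr_basis, dif_pos h]
  generalize hτ : h.choose = τ
  have hτσ : c ∘ τ = c ∘ σ := hτ ▸ h.choose_spec
  have hfix : c ∘ (σ * τ⁻¹ : Equiv.Perm (Fin d)) = c := by
    funext i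
    have := congrFun hτσ (τ⁻¹ i)
    simpa using this.symm
  have h1 := congrArg (superAct M τ) (hy _ hfix)
  rw [← superAct_mul, inv_mul_cancel_right, map_smul] at h1
  rw [h1, smul_smul, ← scalarSign_mul]
  congr 1
  simp only [scalarSign, Equiv.Perm.sign_mul, Equiv.Perm.sign_inv]
  push_cast
  rw [← mul_assoc]
  exact (one_mul _).symm.trans (congrArg (· * _) (scalarSign_mul_self (k := k) σ).symm)

theorem extendMap_of_not_orbit {a : Fin d → I} (ha : ¬ ∃ σ : Equiv.Perm (Fin d), c ∘ σ = a) :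
    extendMap c y (tensorBasis k I d a) = 0 := by
  rw [extendMap, Module.Basis.constr_basis, dif_neg ha]

theorem extendMap_apply_mem (hy : IsSignedFor c y) (P : Submodule k (M.tpow d))
    (hP : ∀ σ, superAct M σ y ∈ P) (x : (oddSpace k I).tpow d) : extendMap c y x ∈ P := by
  have h : Submodule.span k (Set.range (tensorBasis k I d)) ≤ P.comap (extendMap c y) := by
    refine Submodule.span_le.2 ?_
    rintro _ ⟨a, rfl⟩
    change extendMap c y _ ∈ P
    by_cases ha : ∃ σ : Equiv.Perm (Fin d), c ∘ σ = a
    · obtain ⟨σ, rfl⟩ := ha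
      rw [extendMap_of_orbit hy]
      exact P.smul_mem _ (hP σ)
    · rw [extendMap_of_not_orbit ha]
      exact P.zero_mem
  rw [Module.Basis.span_eq] at h
  exact h trivial

theorem extendMap_self (hy : IsSignedFor c y) : extendMap c y (tensorBasis k I d c) = y := by
  have h1 : superAct M 1 y = scalarSign k (1 : Equiv.Perm (Fin d)) • y := hy 1 rfl
  have := extendMap_of_orbit hy 1
  rwa [h1, scalarSign_one, one_smul, one_smul] at this

/-- This is Frobenius reciprocity: the span of the orbit of `e_c` is induced from the sign character
of the stabilizer of `c`. The other orbits span a stable complement, which is sent to zero. -/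
theorem extendMap_mem (hy : IsSignedFor c y) :
    extendMap c y ∈ equivHom (⊤ : Subgroup (Equiv.Perm (Fin d))) (oddSpace k I) M := by
  intro τ _
  refine (tensorBasis k I d).ext fun a => ?_
  rw [LinearMap.comp_apply, LinearMap.comp_apply, superAct_tensorBasis, map_smul]
  by_cases ha : ∃ σ : Equiv.Perm (Fin d), c ∘ σ = a
  · obtain ⟨σ, rfl⟩ := ha
    have h : (c ∘ σ) ∘ τ = c ∘ (σ * τ : Equiv.Perm (Fin d)) := rfl
    rw [h, extendMap_of_orbit hy, extendMap_of_orbit hy, superAct_mul, map_smul, smul_smul,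
      scalarSign_mul, mul_left_comm, scalarSign_mul_self, mul_one]
  · rw [extendMap_of_not_orbit ha, extendMap_of_not_orbit, map_zero, smul_zero]
    rintro ⟨σ, hσ⟩
    refine ha ⟨σ * τ⁻¹, funext fun i => ?_⟩
    simpa using congrFun hσ (τ⁻¹ i)

/-- `extendMap` as a morphism of `Γ^d`. -/
noncomputable def extendHom (c : Fin d → I) {M : SVec k} (y : M.tpow d) (hy : IsSignedFor c y) :
    GammaHom d (oddSpace k I) M :=
  ⟨extendMap c y, extendMap_mem hy⟩

theorem superAct_mem_part {e : ZMod 2} (σ : Equiv.Perm (Fin d)) (he : y ∈ (M.tpow d).part e) :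
    superAct M σ y ∈ (M.tpow d).part e := by
  simpa using superAct_mem_homPart M σ e y he

/-- The source lives only in degree `d`, so a map with values in degree `e` has degree `e - d`,
which equals `e + d` mod 2. -/
theorem extendHom_isHomogeneous (hy : IsSignedFor c y) {e : ZMod 2}
    (he : y ∈ (M.tpow d).part e) : (extendHom c y hy).IsHomogeneous (e + d) := by
  have hmem : ∀ x, extendMap c y x ∈ (M.tpow d).part e :=
    fun x => extendMap_apply_mem hy _ (fun σ => superAct_mem_part σ he) x
  intro δ x hx
  by_cases hδ : δ = d
  · subst hδ
    rw [add_assoc, CharTwo.add_self_eq_zero, add_zero]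
    exact hmem x
  · rw [oddSpace_tpow_eq_zero hδ hx, map_zero]
    exact Submodule.zero_mem _

theorem isSignedFor_tensorBasis (c : Fin d → I) : IsSignedFor c (tensorBasis k I d c) :=
  fun σ hσ => by rw [superAct_tensorBasis, hσ]

/-- The idempotent of `Γ^d End(k^{0|I})` given by `c` maps onto the weight space of `c`. -/
theorem extendMap_tensorBasis_mem_span (c : Fin d → I) (x : (oddSpace k I).tpow d) :
    extendMap c (tensorBasis k I d c) x ∈
      Submodule.span k (Set.range fun σ : Equiv.Perm (Fin d) => tensorBasis k I d (c ∘ σ)) := by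
  refine extendMap_apply_mem (isSignedFor_tensorBasis c) _ (fun σ => ?_) x
  rw [superAct_tensorBasis]
  exact Submodule.smul_mem _ _ (Submodule.subset_span ⟨σ, rfl⟩)

/-! ## Coinvariants of tensor powers of purely odd superspaces -/

theorem mkQ_superAct {H : Subgroup (Equiv.Perm (Fin d))} {σ : Equiv.Perm (Fin d)} (hσ : σ ∈ H)
    (M : SVec k) (x : M.tpow d) :
    (symRel H M).mkQ (superAct M σ x) = (symRel H M).mkQ x := by
  rw [← sub_eq_zero, ← map_sub]
  exact (Submodule.Quotient.mk_eq_zero _).2 (Submodule.subset_span ⟨σ, hσ, x, rfl⟩)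

/-- On odd vectors the coinvariants are alternating in each block, as exterior powers are. -/
theorem mkQ_tensorBasis_comp {H : Subgroup (Equiv.Perm (Fin d))} {σ : Equiv.Perm (Fin d)}
    (hσ : σ ∈ H) (a : Fin d → I) :
    (symRel H (oddSpace k I)).mkQ (tensorBasis k I d (a ∘ σ)) =
      scalarSign k σ • (symRel H (oddSpace k I)).mkQ (tensorBasis k I d a) := by
  rw [← mkQ_superAct hσ _ (tensorBasis k I d a), superAct_tensorBasis, map_smul, smul_smul,
    scalarSign_mul_self, one_smul]

/-- The transposition fixes the word but has sign -1, so the class is its own negative. This is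
where characteristic different from 2 is needed. -/
theorem mkQ_tensorBasis_eq_zero (hk : ringChar k ≠ 2) {H : Subgroup (Equiv.Perm (Fin d))}
    {i j : Fin d} (hij : i ≠ j) (hH : Equiv.swap i j ∈ H) {a : Fin d → I} (ha : a i = a j) :
    (symRel H (oddSpace k I)).mkQ (tensorBasis k I d a) = 0 := by
  have h1 := mkQ_tensorBasis_comp (k := k) hH a
  have h2 : a ∘ Equiv.swap i j = a := by
    funext l
    rcases eq_or_ne l i with rfl | hi
    · simp [ha]
    rcases eq_or_ne l j with rfl | hj
    · simp [ha]
    · simp [Equiv.swap_apply_of_ne_of_ne hi hj]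
  have h3 : scalarSign k (Equiv.swap i j) = -1 := by simp [scalarSign, Equiv.Perm.sign_swap hij]
  rw [h2, h3, neg_one_smul, ← add_eq_zero_iff_eq_neg, ← two_smul k] at h1
  exact (smul_eq_zero.1 h1).resolve_left (Ring.two_ne_zero hk)

theorem mkQ_tensorBasis_ne_zero {H : Subgroup (Equiv.Perm (Fin d))} {b : Fin d → I}
    (hb : ∀ σ ∈ H, b ∘ σ = b → σ = 1) :
    (symRel H (oddSpace k I)).mkQ (tensorBasis k I d b) ≠ 0 := by
  classical
  -- The alternating sum of coordinates over the `H`-orbit of `b` is invariant, so it kills the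
  -- relations. The stabilizer of `b` in `H` being trivial, its value on `e_b` is 1.
  let φ : (oddSpace k I).tpow d →ₗ[k] k :=
    ∑ σ : H, scalarSign k (σ : Equiv.Perm (Fin d)) •
      (tensorBasis k I d).coord (b ∘ (σ : Equiv.Perm (Fin d)))
  have hφ : ∀ a, φ (tensorBasis k I d a) =
      ∑ σ : H, if a = b ∘ (σ : Equiv.Perm (Fin d)) then
        scalarSign k (σ : Equiv.Perm (Fin d)) else 0 := by
    intro a
    simp [φ, LinearMap.sum_apply, Finsupp.single_apply]
  have hinv : ∀ τ ∈ H, φ ∘ₗ superAct (oddSpace k I) τ = φ := by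
    intro τ hτ
    refine (tensorBasis k I d).ext fun a => ?_
    rw [LinearMap.comp_apply, superAct_tensorBasis, map_smul, hφ, hφ,
      ← Equiv.sum_comp (Equiv.mulRight (⟨τ, hτ⟩ : H)), Finset.smul_sum]
    refine Finset.sum_congr rfl fun σ _ => ?_
    have hiff : a ∘ τ = b ∘ (σ * τ : Equiv.Perm (Fin d)) ↔
        a = b ∘ (σ : Equiv.Perm (Fin d)) := by
      constructor
      · intro h
        funext i
        simpa using congrFun h (τ⁻¹ i)
      · rintro rfl
        rfl
    simp only [Equiv.coe_mulRight, Subgroup.coe_mul, hiff]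
    split_ifs
    · rw [scalarSign_mul, smul_eq_mul, mul_left_comm, scalarSign_mul_self, mul_one]
    · rw [smul_zero]
  have hker : symRel H (oddSpace k I) ≤ LinearMap.ker φ := by
    refine Submodule.span_le.2 ?_
    rintro _ ⟨σ, hσ, x, rfl⟩
    have := LinearMap.congr_fun (hinv σ hσ) x
    simpa [sub_eq_zero] using this
  intro h0
  have h1 : φ (tensorBasis k I d b) = 0 := hker ((Submodule.Quotient.mk_eq_zero _).1 h0)
  rw [hφ, Finset.sum_eq_single (1 : H)] at h1
  · simp [scalarSign_one] at h1
  · intro σ _ hσ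
    exact if_neg fun h => hσ (Subtype.ext (hb σ σ.2 h.symm))
  · simp

end OddSpace

/-! ## The generator of a Schur superfunctor -/

/-- The columns of a Young diagram. -/
abbrev Column (lam : YoungDiagram) : Type := lam.cells.image Prod.snd

/-- The columns of the cells, in the column by column numbering. -/
def colWord (lam : YoungDiagram) (h : lam.card = d) (i : Fin d) : Column lam :=
  ⟨(colReading lam h i).1.2, Finset.mem_image_of_mem _ (colReading lam h i).2⟩

/-- The columns of the cells, in the row by row numbering. -/
def rowWord (lam : YoungDiagram) (h : lam.card = d) (i : Fin d) : Column lam :=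
  ⟨(rowReading lam h i).1.2, Finset.mem_image_of_mem _ (rowReading lam h i).2⟩

theorem colWord_comp_sigmaPerm (lam : YoungDiagram) (h : lam.card = d) :
    colWord lam h ∘ sigmaPerm lam h = rowWord lam h := by
  funext i
  simp [colWord, rowWord, sigmaPerm]

theorem mem_colGroup_iff (lam : YoungDiagram) (h : lam.card = d) (σ : Equiv.Perm (Fin d)) :
    σ ∈ colGroup lam h ↔ colWord lam h ∘ σ = colWord lam h := by
  refine Iff.trans ?_ funext_iff.symm
  exact forall_congr' fun i =>
    (Subtype.ext_iff (a1 := colWord lam h (σ i)) (a2 := colWord lam h i)).symm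

theorem superAct_oddLine_tprod (σ : Equiv.Perm (Fin d)) (v : Fin d → oddLine k) :
    superAct (oddLine k) σ (PiTensorProduct.tprod k v) =
      scalarSign k σ • PiTensorProduct.tprod k fun i => v (σ i) := by
  rw [superAct_tprod _ σ (fun _ => 1) v, superSign_one_eq_sign]
  · rfl
  · intro i
    simp only [oddLine, if_true]
    trivial

theorem isSignedFor_deltaPi (lam : YoungDiagram) (h : lam.card = d) {M : SVec k}
    (f : gammaPi lam h M) : IsSignedFor (colWord lam h) (deltaPi lam h M f) := by
  intro σ hσ
  have h1 := LinearMap.congr_fun (f.2 σ ((mem_colGroup_iff lam h σ).2 hσ))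
    (PiTensorProduct.tprod k fun _ : Fin d => (1 : k) : (oddLine k).tpow d)
  have h2 := (congrArg f.1 (superAct_oddLine_tprod (k := k) σ fun _ : Fin d => (1 : k))).trans
    (map_smul f.1 _ _)
  exact h1.symm.trans h2

/-- The source is a line on which permutations act by the sign, so sending its generator to `y` is
equivariant. With `isSignedFor_deltaPi` this identifies the image of Δ_Π. -/
theorem exists_deltaPi_eq (lam : YoungDiagram) (h : lam.card = d) {M : SVec k} {y : M.tpow d}
    (hy : IsSignedFor (colWord lam h) y) : ∃ f, deltaPi lam h M f = y := by
  let g : (oddLine k).tpow d →ₗ[k] M.tpow d :=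
    PiTensorProduct.lift (MultilinearMap.mkPiRing k (Fin d) y)
  have hg : ∀ v : Fin d → k, g (PiTensorProduct.tprod k v) = (∏ i, v i) • y := fun v =>
    (PiTensorProduct.lift.tprod _).trans (MultilinearMap.mkPiRing_apply _ _)
  refine ⟨⟨g, fun σ hσ => ?_⟩, ?_⟩
  · refine PiTensorProduct.ext (MultilinearMap.ext fun v => ?_)
    change g (superAct (oddLine k) σ (PiTensorProduct.tprod k v)) =
      superAct M σ (g (PiTensorProduct.tprod k v))
    rw [superAct_oddLine_tprod, map_smul]
    refine (congrArg (scalarSign k σ • ·) (hg fun i => v (σ i))).trans ?_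
    refine Eq.trans ?_ (congrArg (superAct M σ) (hg v)).symm
    rw [map_smul, hy σ ((mem_colGroup_iff lam h σ).1 hσ), smul_comm]
    congr 1
    exact Equiv.prod_comp (M := k) σ v
  · refine (hg fun _ => 1).trans ?_
    rw [Finset.prod_const_one, one_smul]

/-- The element of `Ŝ_λ(k^{0|λ₁})` that is the image of the tensor product of the basis vectors
`e_j`, one for each cell, where `j` is the column of the cell. -/
noncomputable def schurGen (k : Type u) [Field k] (lam : YoungDiagram) (h : lam.card = d) :
    (schur k lam h).obj (oddSpace k (Column lam)) :=
  ⟨_, (exists_deltaPi_eq lam h (isSignedFor_tensorBasis (k := k) (colWord lam h))).choose, rfl⟩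

theorem schurGen_eq_mkQ_superAct (lam : YoungDiagram) (h : lam.card = d) :
    (schurGen k lam h).1 = (symRel (rowGroup lam h) (oddSpace k (Column lam))).mkQ
      (superAct _ (sigmaPerm lam h) (tensorBasis k (Column lam) d (colWord lam h))) :=
  congrArg (fun x => (symRel (rowGroup lam h) (oddSpace k (Column lam))).mkQ
      (superAct _ (sigmaPerm lam h) x))
    (exists_deltaPi_eq lam h (isSignedFor_tensorBasis (k := k) (colWord lam h))).choose_spec

theorem schurGen_eq_smul (lam : YoungDiagram) (h : lam.card = d) :
    (schurGen k lam h).1 = scalarSign k (sigmaPerm lam h) •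
      (symRel (rowGroup lam h) (oddSpace k (Column lam))).mkQ
        (tensorBasis k (Column lam) d (rowWord lam h)) := by
  rw [schurGen_eq_mkQ_superAct, superAct_tensorBasis, map_smul, colWord_comp_sigmaPerm]

theorem eq_of_row_eq_of_rowWord_eq {lam : YoungDiagram} {h : lam.card = d} {i j : Fin d}
    (h1 : (rowReading lam h i).1.1 = (rowReading lam h j).1.1)
    (h2 : rowWord lam h i = rowWord lam h j) : i = j :=
  (rowReading lam h).injective (Subtype.ext (Prod.ext h1 (congrArg Subtype.val h2)))

theorem schurGen_ne_zero (lam : YoungDiagram) (h : lam.card = d) : schurGen k lam h ≠ 0 := by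
  intro h0
  have h1 := congrArg Subtype.val h0
  rw [schurGen_eq_smul] at h1
  refine mkQ_tensorBasis_ne_zero (k := k) (H := rowGroup lam h) (b := rowWord lam h) ?_
    ((smul_eq_zero.1 h1).resolve_left (scalarSign_ne_zero _))
  intro σ hσ hb
  exact Equiv.ext fun i => eq_of_row_eq_of_rowWord_eq (hσ i) (congrFun hb i)

theorem schur_map_schurGen (lam : YoungDiagram) (h : lam.card = d) {M : SVec k}
    (F : GammaHom d (oddSpace k (Column lam)) M) :
    ((schur k lam h).map F (schurGen k lam h)).1 = (symRel (rowGroup lam h) M).mkQ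
      (superAct M (sigmaPerm lam h) (F.1 (tensorBasis k (Column lam) d (colWord lam h)))) := by
  change symMap (rowGroup lam h) F (schurGen k lam h).1 = _
  rw [schurGen_eq_mkQ_superAct]
  exact congrArg (symRel (rowGroup lam h) M).mkQ
    (LinearMap.congr_fun (F.2 (sigmaPerm lam h) trivial) _)

/-- `schurGen` generates the Schur superfunctor. -/
theorem mem_span_map_schurGen (lam : YoungDiagram) (h : lam.card = d) (M : SVec k)
    (x : (schur k lam h).obj M) :
    x ∈ Submodule.span k {z | ∃ (δ : ZMod 2) (F : GammaHom d (oddSpace k (Column lam)) M),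
      F.IsHomogeneous δ ∧ (schur k lam h).map F (schurGen k lam h) = z} := by
  obtain ⟨_, f, rfl⟩ := x
  have hy := isSignedFor_deltaPi lam h f
  -- The tensor is split into its even and odd parts because naturality in Pol^I_d is stated only
  -- for homogeneous morphisms.
  have hx : (⟨theta lam h M f, f, rfl⟩ : (schur k lam h).obj M) =
      (schur k lam h).map (extendHom _ _ (isSignedFor_proj hy 0)) (schurGen k lam h) +
      (schur k lam h).map (extendHom _ _ (isSignedFor_proj hy 1)) (schurGen k lam h) := by
    refine Subtype.ext ?_
    change theta lam h M f = ((schur k lam h).map _ _).1 + ((schur k lam h).map _ _).1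
    rw [schur_map_schurGen, schur_map_schurGen, ← map_add, ← map_add]
    refine congrArg (fun x => (symRel (rowGroup lam h) M).mkQ
      (superAct M (sigmaPerm lam h) x)) ?_
    change _ = extendMap _ _ _ + extendMap _ _ _
    rw [extendMap_self (isSignedFor_proj hy 0), extendMap_self (isSignedFor_proj hy 1),
      SVec.proj_add]
  rw [hx]
  exact Submodule.add_mem _
    (Submodule.subset_span
      ⟨_, _, extendHom_isHomogeneous _ ((M.tpow d).proj_mem 0 _), rfl⟩)
    (Submodule.subset_span
      ⟨_, _, extendHom_isHomogeneous _ ((M.tpow d).proj_mem 1 _), rfl⟩)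

/-! ## The weight space of the generator -/

/-- The weight space is at most a line: a filling with a repeated column in some row vanishes, and
any other filling differs from the standard one by a permutation within rows, hence by a sign. -/
theorem mkQ_colWord_comp_mem_span (hk : ringChar k ≠ 2) (lam : YoungDiagram) (h : lam.card = d)
    (σ : Equiv.Perm (Fin d)) :
    (symRel (rowGroup lam h) (oddSpace k (Column lam))).mkQ
      (tensorBasis k (Column lam) d (colWord lam h ∘ σ)) ∈
      Submodule.span k {(schurGen k lam h).1} := by
  set ρ : Equiv.Perm (Fin d) := (sigmaPerm lam h)⁻¹ * σ
  have hρ : colWord lam h ∘ σ = rowWord lam h ∘ ρ := by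
    rw [← colWord_comp_sigmaPerm]
    funext i
    simp [ρ]
  rw [hρ]
  by_cases hinj : ∀ i j, (rowReading lam h i).1.1 = (rowReading lam h j).1.1 →
      (rowReading lam h (ρ i)).1.2 = (rowReading lam h (ρ j)).1.2 → i = j
  · have hmem := mem_of_injective_on_rows lam (rowReading lam h) ρ hinj
    -- `t` moves each cell within its own row to the column prescribed by `ρ`. Such a cell exists by
    -- the counting lemma.
    let t : Fin d → Fin d := fun i =>
      (rowReading lam h).symm ⟨_, (YoungDiagram.mem_cells _).2 (hmem i)⟩
    have ht : ∀ i, (rowReading lam h (t i)).1 =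
        ((rowReading lam h i).1.1, (rowReading lam h (ρ i)).1.2) := fun i => by simp [t]
    have htinj : Function.Injective t := fun i j hij => by
      have h1 : (rowReading lam h (t i)).1 = (rowReading lam h (t j)).1 := by rw [hij]
      rw [ht, ht, Prod.mk.injEq] at h1
      exact hinj i j h1.1 h1.2
    let τ : Equiv.Perm (Fin d) := Equiv.ofBijective t (Finite.injective_iff_bijective.1 htinj)
    have hτ : τ ∈ rowGroup lam h := fun i => (congrArg Prod.fst (ht i) :)
    have hw : rowWord lam h ∘ ρ = rowWord lam h ∘ τ := funext fun i =>
      Subtype.ext (congrArg Prod.snd (ht i)).symm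
    rw [hw, mkQ_tensorBasis_comp hτ, Submodule.mem_span_singleton]
    refine ⟨scalarSign k τ * scalarSign k (sigmaPerm lam h), ?_⟩
    rw [schurGen_eq_smul, smul_smul, mul_assoc, scalarSign_mul_self, mul_one]
  · push Not at hinj
    obtain ⟨i, j, hrow, hcol, hij⟩ := hinj
    rw [mkQ_tensorBasis_eq_zero hk hij _ (Subtype.ext hcol)]
    · exact Submodule.zero_mem _
    · intro l
      rcases eq_or_ne l i with rfl | hi
      · simp [hrow]
      rcases eq_or_ne l j with rfl | hj
      · simp [hrow]
      · simp [Equiv.swap_apply_of_ne_of_ne hi hj]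

theorem mem_schur_oddSpace_part (lam : YoungDiagram) (h : lam.card = d)
    (x : (schur k lam h).obj (oddSpace k (Column lam))) :
    x ∈ ((schur k lam h).obj (oddSpace k (Column lam))).part d := by
  obtain ⟨x, hx⟩ := x
  obtain ⟨y, rfl⟩ := Submodule.mkQ_surjective _ x
  exact ⟨y, mem_oddSpace_tpow_part y, rfl⟩

/-- The idempotent of `Γ^d` cutting out the weight space of `schurGen`. -/
noncomputable def weightHom (k : Type u) [Field k] (lam : YoungDiagram) (h : lam.card = d) :
    GammaHom d (oddSpace k (Column lam)) (oddSpace k (Column lam)) :=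
  extendHom _ _ (isSignedFor_tensorBasis (colWord lam h))

theorem weightHom_isHomogeneous (lam : YoungDiagram) (h : lam.card = d) :
    (weightHom k lam h).IsHomogeneous 0 := by
  have := extendHom_isHomogeneous (isSignedFor_tensorBasis (k := k) (colWord lam h))
    (mem_oddSpace_tpow_part _)
  rwa [CharTwo.add_self_eq_zero] at this

theorem map_weightHom_schurGen (lam : YoungDiagram) (h : lam.card = d) :
    (schur k lam h).map (weightHom k lam h) (schurGen k lam h) = schurGen k lam h := by
  refine Subtype.ext ?_
  rw [schur_map_schurGen, schurGen_eq_mkQ_superAct]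
  change (symRel _ _).mkQ (superAct _ _ (extendMap _ _ _)) = _
  rw [extendMap_self (isSignedFor_tensorBasis (colWord lam h))]

/-- The idempotent already maps `V^{⊗d}` into the span of the rearrangements of `e_c`, and their
classes all lie on the line of `schurGen`. -/
theorem exists_map_weightHom_eq_smul (hk : ringChar k ≠ 2) (lam : YoungDiagram)
    (h : lam.card = d) (x : (schur k lam h).obj (oddSpace k (Column lam))) :
    ∃ r : k, (schur k lam h).map (weightHom k lam h) x = r • schurGen k lam h := by
  obtain ⟨x, hx⟩ := x
  obtain ⟨y, rfl⟩ := Submodule.mkQ_surjective _ x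
  have hle : Submodule.span k (Set.range fun σ : Equiv.Perm (Fin d) =>
      tensorBasis k (Column lam) d (colWord lam h ∘ σ)) ≤
      (Submodule.span k {(schurGen k lam h).1}).comap
        (symRel (rowGroup lam h) (oddSpace k (Column lam))).mkQ := by
    refine Submodule.span_le.2 ?_
    rintro _ ⟨σ, rfl⟩
    exact mkQ_colWord_comp_mem_span hk lam h σ
  obtain ⟨r, hr⟩ := Submodule.mem_span_singleton.1
    (hle (extendMap_tensorBasis_mem_span (colWord lam h) y))
  exact ⟨r, Subtype.ext hr.symm⟩

/-! ## Endomorphisms and indecomposability -/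

/-- An endomorphism of a Schur superfunctor is multiplication by a scalar. -/
theorem exists_app_eq_smul (hk : ringChar k ≠ 2) (lam : YoungDiagram) (h : lam.card = d)
    (η : Pol.Hom (schur k lam h) (schur k lam h)) :
    ∃ r : k, ∀ M x, η.app 0 M x = r • x ∧ η.app 1 M x = 0 := by
  obtain ⟨r, hr⟩ := exists_map_weightHom_eq_smul hk lam h
    (η.app 0 _ (schurGen k lam h))
  -- The idempotent is even, fixes the generator and commutes with `η₀`, so it also fixes the value
  -- of `η₀` there, which is therefore on the line.
  have h0 : η.app 0 _ (schurGen k lam h) = r • schurGen k lam h := by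
    have h1 := η.natural_apply 0 0 _ (weightHom_isHomogeneous lam h) (schurGen k lam h)
    rw [map_weightHom_schurGen, hr] at h1
    simpa using h1.symm
  -- The value has degree `d + 1`, in a superspace concentrated in degree `d`.
  have h1 : η.app 1 _ (schurGen k lam h) = 0 := by
    have h2 := η.homogeneous 1 _ _ _ (mem_schur_oddSpace_part lam h (schurGen k lam h))
    rw [add_comm] at h2
    exact Submodule.disjoint_def.1 (SVec.isCompl_part _ (d : ZMod 2)).disjoint _
      (mem_schur_oddSpace_part lam h _) h2
  refine ⟨r, fun M x => ?_⟩
  induction mem_span_map_schurGen lam h M x using Submodule.span_induction with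
  | mem x hx =>
    obtain ⟨δ, F, hF, rfl⟩ := hx
    have e0 := η.natural_apply 0 δ F hF (schurGen k lam h)
    have e1 := η.natural_apply 1 δ F hF (schurGen k lam h)
    rw [h0, map_smul] at e0
    rw [h1, map_zero] at e1
    refine ⟨by simpa using e0.symm, (smul_eq_zero.1 e1.symm).resolve_left ?_⟩
    exact pow_ne_zero _ (neg_ne_zero.2 one_ne_zero)
  | zero => simp
  | add x y _ _ hx hy => simp [hx.1, hx.2, hy.1, hy.2]
  | smul c x _ hx => simp [hx.1, hx.2, smul_comm r c]

/-- An idempotent endomorphism of a Schur superfunctor is trivial. -/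
theorem eq_zero_or_eq_id_of_idem (hk : ringChar k ≠ 2) (lam : YoungDiagram) (h : lam.card = d)
    (p : schur k lam h ⟶ schur k lam h) (hp : p ≫ p = p) : p = 0 ∨ p = 𝟙 _ := by
  obtain ⟨r, hr⟩ := exists_app_eq_smul hk lam h p
  -- The even part of `p ≫ p` is `p₀p₀ + p₁p₁`, and `p₁` vanishes.
  have hw : (r * r) • schurGen k lam h = r • schurGen k lam h := by
    have h1 : Pol.Hom.app (Pol.Hom.comp p p) 0 _ (schurGen k lam h) =
        Pol.Hom.app p 0 _ (schurGen k lam h) :=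
      congrArg (fun q : Pol.Hom _ _ => q.app 0 _ (schurGen k lam h)) hp
    rw [(hr _ _).1] at h1
    rw [← h1, mul_smul]
    simp only [Pol.Hom.comp, Pol.sum_zmod_two, LinearMap.add_apply, LinearMap.comp_apply,
      sub_zero, (hr _ _).1, (hr _ _).2, add_zero]
  have hrr : r * r = r := by
    rw [← sub_eq_zero, ← sub_smul, smul_eq_zero, sub_eq_zero] at hw
    exact hw.resolve_right (schurGen_ne_zero lam h)
  rcases IsIdempotentElem.iff_eq_zero_or_one.1 hrr with rfl | rfl
  · refine Or.inl (Pol.hom_ext fun e M x => ?_)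
    rcases zmod_two_cases e with rfl | rfl
    · exact ((hr M x).1).trans (zero_smul k x)
    · exact (hr M x).2
  · refine Or.inr (Pol.hom_ext fun e M x => ?_)
    refine Eq.trans ?_ (Pol.id_app _ e M x).symm
    rcases zmod_two_cases e with rfl | rfl
    · simpa using (hr M x).1
    · simpa using (hr M x).2

theorem schur_not_isZero (lam : YoungDiagram) (h : lam.card = d) : ¬ IsZero (schur k lam h) := by
  intro hz
  have h0 : 𝟙 (schur k lam h) = 0 := hz.eq_of_src _ _
  have h1 : Pol.Hom.app (Pol.Hom.id (schur k lam h)) 0 _ (schurGen k lam h) = 0 :=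
    congrArg (fun q : Pol.Hom _ _ => q.app 0 _ (schurGen k lam h)) h0
  rw [Pol.id_app, if_pos rfl] at h1
  exact schurGen_ne_zero lam h h1

/-- A nonzero object whose idempotent endomorphisms are trivial is indecomposable. -/
theorem indecomposable_of_idem {C : Type*} [Category C] [Preadditive C] [HasBinaryBiproducts C]
    {X : C} (hX : ¬ IsZero X) (hid : ∀ p : X ⟶ X, p ≫ p = p → p = 0 ∨ p = 𝟙 X) :
    Indecomposable X := by
  refine ⟨hX, fun Y Z i => ?_⟩
  -- This is the projection of `X` onto the summand `Y`. If it is zero, it kills the identity of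
  -- `Y`; if it is the identity, it forces that of `Z` to vanish, since `Z` lies in its kernel.
  rcases hid (i.hom ≫ biprod.fst ≫ biprod.inl ≫ i.inv) (by simp) with hp | hp
  · refine Or.inl ((IsZero.iff_id_eq_zero Y).2 ?_)
    calc 𝟙 Y = biprod.inl ≫ i.inv ≫ (i.hom ≫ biprod.fst ≫ biprod.inl ≫ i.inv) ≫ i.hom ≫
        biprod.fst := by simp
      _ = 0 := by rw [hp]; simp
  · refine Or.inr ((IsZero.iff_id_eq_zero Z).2 ?_)
    calc 𝟙 Z = biprod.inr ≫ i.inv ≫ 𝟙 X ≫ i.hom ≫ biprod.snd := by simp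
      _ = 0 := by rw [← hp]; simp

end SuperPoly

theorem mainTheorem3 (k : Type u) [Field k] (hk : ringChar k ≠ 2) (d : ℕ)
    (lam : YoungDiagram) (h : lam.card = d) :
    CategoryTheory.Indecomposable (SuperPoly.schur k lam h) := by
  exact SuperPoly.indecomposable_of_idem (SuperPoly.schur_not_isZero lam h)
    (SuperPoly.eq_zero_or_eq_id_of_idem hk lam h)
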